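/- Let $X$ and $Y$ be Banach spaces (over the same scalar field $\mathbb{R}$ or $\mathbb{C}$), let $I$ and $J$ be countable sets, and let $1<p,q<\infty$ satisfy $1/p+1/q\geq 1$. Suppose that $\{X_i\}_{i\in I}$ is an unconditional finite-dimensional Schauder decomposition of $X$, that is, a family of finite-dimensional (closed) subspaces of $X$ such that every $x\in X$ can be written in a unique way as an unconditionally convergent series $x=\sum_{i\in I}x_i$ with $x_i\in X_i$ for all $i\in I$; write $P_i(x):=x_i$ and $P_C(x):=\sum_{i\in C}P_i(x)$ for finite $C\subseteq I$. Suppose that it has a disjoint lower $p$-estimate: there is a constant $c>0$ such that $$\left(\sum_{k=1}^r\|P_{C_k}(x)\|^p\right)^{1/p}\leq c\,\|x\|$$ for every finite collection $C_1,\dots,C_r$ of pairwise disjoint finite subsets of $I$ and every $x\in X$. Likewise, suppose that $\{Y_j\}_{j\in J}$ is an unconditional finite-dimensional Schauder decomposition of $Y$ having a disjoint lower $q$-estimate. A subset of a Banach space $Z$ is called conditionally weakly compact if every sequence in it has a weakly Cauchy subsequence, and $Z$ is called strongly conditionally weakly compactly generated (SCWCG) if there is a conditionally weakly compact set $G\subseteq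 Z$ such that for every conditionally weakly compact set $C\subseteq Z$ and every $\varepsilon>0$ there is an integer $n\geq 1$ with $C\subseteq nG+\varepsilon B_Z$, where $B_Z$ is the closed unit ball of $Z$. If $X$ and $Y$ are SCWCG, then the projective tensor product $X\widehat{\otimes}_\pi Y$ is SCWCG. Here $X\widehat{\otimes}_\pi Y$ is the completion of the algebraic tensor product $X\otimes Y$ with respect to the norm $\|z\|=\sup\{|S(z)|: S \text{ a continuous bilinear functional on } X\times Y,\ \|S\|\leq 1\}$. -/

import Mathlib

open scoped TensorProduct Pointwise

/-! ### Conditional weak compactness and strong generation -/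

/-- A sequence is weakly Cauchy if every continuous linear functional maps it to a Cauchy
sequence of scalars. -/
def WeaklyCauchySeq (𝕜 : Type*) [RCLike 𝕜] {Z : Type*} [NormedAddCommGroup Z]
    [NormedSpace 𝕜 Z] (u : ℕ → Z) : Prop :=
  ∀ φ : StrongDual 𝕜 Z, CauchySeq (fun n => φ (u n))

/-- A set is conditionally weakly compact (weakly precompact) if every sequence in it has a
weakly Cauchy subsequence. -/
def IsConditionallyWeaklyCompact (𝕜 : Type*) [RCLike 𝕜] {Z : Type*} [NormedAddCommGroup Z]
    [NormedSpace 𝕜 Z] (D : Set Z) : Prop :=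
  ∀ u : ℕ → Z, (∀ n, u n ∈ D) → ∃ s : ℕ → ℕ, StrictMono s ∧ WeaklyCauchySeq 𝕜 (u ∘ s)

/-- `Z` is strongly conditionally weakly compactly generated. The scalar multiple is taken over
`𝕜` because `(n : 𝕜) • G` is the dilation `nG = {n g : g ∈ G}`; `Metric.closedBall 0 ε` is
`ε B_Z`. -/
def IsSCWCG (𝕜 : Type*) [RCLike 𝕜] (Z : Type*) [NormedAddCommGroup Z]
    [NormedSpace 𝕜 Z] : Prop :=
  ∃ G : Set Z, IsConditionallyWeaklyCompact 𝕜 G ∧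
    ∀ C : Set Z, IsConditionallyWeaklyCompact 𝕜 C → ∀ ε : ℝ, 0 < ε →
      ∃ n : ℕ, 1 ≤ n ∧ C ⊆ (n : 𝕜) • G + Metric.closedBall (0 : Z) ε

/-! ### Unconditional Schauder decompositions -/

/-- A family of closed subspaces is an unconditional Schauder decomposition if every vector has a
unique unconditionally convergent expansion (`HasSum`) with terms in these subspaces. -/
structure IsUnconditionalSchauderDecomposition {𝕜 : Type*} [RCLike 𝕜] {X : Type*}
    [NormedAddCommGroup X] [NormedSpace 𝕜 X] {I : Type*} (V : I → Submodule 𝕜 X) : Prop where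
  isClosed : ∀ i, IsClosed (V i : Set X)
  existsUnique : ∀ x : X, ∃! f : I → X, (∀ i, f i ∈ V i) ∧ HasSum f x

namespace IsUnconditionalSchauderDecomposition

variable {𝕜 : Type*} [RCLike 𝕜] {X : Type*} [NormedAddCommGroup X] [NormedSpace 𝕜 X]
  {I : Type*} {V : I → Submodule 𝕜 X}

/-- The projection `P_i`: the `i`-th term of the expansion of `x`. -/
noncomputable def proj (h : IsUnconditionalSchauderDecomposition V) (i : I) (x : X) : X :=
  (h.existsUnique x).choose i

/-- The projection `P_C` for a finite set `C` of indices. -/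
noncomputable def finProj (h : IsUnconditionalSchauderDecomposition V) (C : Finset I) (x : X) :
    X :=
  ∑ i ∈ C, h.proj i x

theorem proj_mem (h : IsUnconditionalSchauderDecomposition V) (i : I) (x : X) :
    h.proj i x ∈ V i :=
  (h.existsUnique x).choose_spec.1.1 i

theorem hasSum_proj (h : IsUnconditionalSchauderDecomposition V) (x : X) :
    HasSum (fun i => h.proj i x) x :=
  (h.existsUnique x).choose_spec.1.2

/-- The decomposition has a disjoint lower `p`-estimate. -/
def HasDisjointLowerEstimate (h : IsUnconditionalSchauderDecomposition V) (p : ℝ) : Prop :=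
  ∃ c : ℝ, 0 < c ∧ ∀ (r : ℕ) (C : Fin r → Finset I), (∀ k l, k ≠ l → Disjoint (C k) (C l)) →
    ∀ x : X, (∑ k, ‖h.finProj (C k) x‖ ^ p) ^ (1 / p) ≤ c * ‖x‖

end IsUnconditionalSchauderDecomposition

/-! ### The projective tensor product -/

/-- The algebraic tensor product `X ⊗ Y`, as a type that will carry the projective norm. -/
def AlgProjTensor (𝕜 : Type*) [RCLike 𝕜] (X Y : Type*) [NormedAddCommGroup X]
    [NormedSpace 𝕜 X] [NormedAddCommGroup Y] [NormedSpace 𝕜 Y] : Type _ :=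
  X ⊗[𝕜] Y

namespace AlgProjTensor

variable {𝕜 : Type*} [RCLike 𝕜] {X Y : Type*} [NormedAddCommGroup X] [NormedSpace 𝕜 X]
  [NormedAddCommGroup Y] [NormedSpace 𝕜 Y]

noncomputable instance : AddCommGroup (AlgProjTensor 𝕜 X Y) :=
  inferInstanceAs (AddCommGroup (X ⊗[𝕜] Y))

noncomputable instance : Module 𝕜 (AlgProjTensor 𝕜 X Y) :=
  inferInstanceAs (Module 𝕜 (X ⊗[𝕜] Y))

/-- The linear functional on `X ⊗ Y` induced by a continuous bilinear functional `S`, that is,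
the one with `x ⊗ₜ y ↦ S x y`. -/
noncomputable def evalBilin (S : X →L[𝕜] Y →L[𝕜] 𝕜) : AlgProjTensor 𝕜 X Y →ₗ[𝕜] 𝕜 :=
  (TensorProduct.lift (S.toLinearMap₁₂) : X ⊗[𝕜] Y →ₗ[𝕜] 𝕜)

/-- The projective norm `sup {|S(z)| : S bilinear, ‖S‖ ≤ 1}`. The norm of
`S : X →L[𝕜] Y →L[𝕜] 𝕜` is `sup {|S(x, y)| : ‖x‖ ≤ 1, ‖y‖ ≤ 1}`. -/
noncomputable def projNorm (z : AlgProjTensor 𝕜 X Y) : ℝ :=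
  ⨆ S : {S : X →L[𝕜] Y →L[𝕜] 𝕜 // ‖S‖ ≤ 1}, ‖evalBilin S.1 z‖

theorem bddAbove_projNorm (z : AlgProjTensor 𝕜 X Y) :
    BddAbove (Set.range fun S : {S : X →L[𝕜] Y →L[𝕜] 𝕜 // ‖S‖ ≤ 1} => ‖evalBilin S.1 z‖) := by
  suffices H : ∃ M : ℝ, ∀ S : X →L[𝕜] Y →L[𝕜] 𝕜, ‖S‖ ≤ 1 → ‖evalBilin S z‖ ≤ M by
    obtain ⟨M, hM⟩ := H
    refine ⟨M, ?_⟩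
    rintro _ ⟨S, rfl⟩
    exact hM S.1 S.2
  refine TensorProduct.induction_on (R := 𝕜) (M := X) (N := Y)
    (motive := fun z => ∃ M : ℝ, ∀ S : X →L[𝕜] Y →L[𝕜] 𝕜, ‖S‖ ≤ 1 →
      ‖evalBilin S (z : AlgProjTensor 𝕜 X Y)‖ ≤ M) z ?_ ?_ ?_
  · refine ⟨0, fun S _ => ?_⟩
    have h0 : evalBilin S (0 : AlgProjTensor 𝕜 X Y) = 0 := map_zero _
    exact (norm_le_zero_iff).2 h0
  · intro x y
    refine ⟨‖x‖ * ‖y‖, fun S hS => ?_⟩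
    change ‖S x y‖ ≤ _
    calc ‖S x y‖ ≤ ‖S‖ * ‖x‖ * ‖y‖ := S.le_opNorm₂ x y
      _ ≤ 1 * ‖x‖ * ‖y‖ := by gcongr
      _ = ‖x‖ * ‖y‖ := by ring
  · rintro a b ⟨M, hM⟩ ⟨N, hN⟩
    refine ⟨M + N, fun S hS => ?_⟩
    have hab : evalBilin S ((a + b : X ⊗[𝕜] Y) : AlgProjTensor 𝕜 X Y) =
        evalBilin S (a : AlgProjTensor 𝕜 X Y) + evalBilin S (b : AlgProjTensor 𝕜 X Y) :=
      (evalBilin S).map_add a b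
    rw [hab]
    exact (norm_add_le _ _).trans (add_le_add (hM S hS) (hN S hS))

theorem norm_evalBilin_le_projNorm (S : X →L[𝕜] Y →L[𝕜] 𝕜) (hS : ‖S‖ ≤ 1)
    (z : AlgProjTensor 𝕜 X Y) : ‖evalBilin S z‖ ≤ projNorm z :=
  le_ciSup (bddAbove_projNorm z) ⟨S, hS⟩

theorem projNorm_le {z : AlgProjTensor 𝕜 X Y} {M : ℝ}
    (h : ∀ S : X →L[𝕜] Y →L[𝕜] 𝕜, ‖S‖ ≤ 1 → ‖evalBilin S z‖ ≤ M) : projNorm z ≤ M := by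
  have : Nonempty {S : X →L[𝕜] Y →L[𝕜] 𝕜 // ‖S‖ ≤ 1} :=
    ⟨⟨0, ContinuousLinearMap.opNorm_zero.trans_le zero_le_one⟩⟩
  exact ciSup_le fun S => h S.1 S.2

/-- The projective norm as a seminorm (it is in fact a norm). -/
noncomputable def projSeminorm : Seminorm 𝕜 (AlgProjTensor 𝕜 X Y) :=
  Seminorm.ofSMulLE projNorm
    (le_antisymm (projNorm_le fun S _ => by simp)
      ((norm_nonneg (evalBilin (0 : X →L[𝕜] Y →L[𝕜] 𝕜) 0)).trans
        (norm_evalBilin_le_projNorm 0 (ContinuousLinearMap.opNorm_zero.trans_le zero_le_one) 0)))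
    (fun a b => projNorm_le fun S hS => by
      rw [map_add]
      exact (norm_add_le _ _).trans (add_le_add (norm_evalBilin_le_projNorm S hS a)
        (norm_evalBilin_le_projNorm S hS b)))
    (fun c a => projNorm_le fun S hS => by
      rw [map_smul, norm_smul]
      exact mul_le_mul_of_nonneg_left (norm_evalBilin_le_projNorm S hS a) (norm_nonneg c))

noncomputable instance : SeminormedAddCommGroup (AlgProjTensor 𝕜 X Y) :=
  (projSeminorm (𝕜 := 𝕜) (X := X) (Y := Y)).toAddGroupSeminorm.toSeminormedAddCommGroup

noncomputable instance : NormedSpace 𝕜 (AlgProjTensor 𝕜 X Y) where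
  norm_smul_le c z := (map_smul_eq_mul (projSeminorm (𝕜 := 𝕜) (X := X) (Y := Y)) c z).le

end AlgProjTensor

/-- The projective tensor product of `X` and `Y`: the completion of the algebraic tensor product
with respect to the projective norm. -/
abbrev ProjectiveTensorProduct (𝕜 : Type*) [RCLike 𝕜] (X Y : Type*) [NormedAddCommGroup X]
    [NormedSpace 𝕜 X] [NormedAddCommGroup Y] [NormedSpace 𝕜 Y] : Type _ :=
  UniformSpace.Completion (AlgProjTensor 𝕜 X Y)

/-! ### Conditionally weakly compact sets -/

section WeaklyCauchy

variable {𝕜 : Type*} [RCLike 𝕜] {Z Z' : Type*} [NormedAddCommGroup Z] [NormedSpace 𝕜 Z]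
  [NormedAddCommGroup Z'] [NormedSpace 𝕜 Z']

/-! Write `P_A`, `Q_B` for the projections onto finitely many summands and split the identity of the
tensor product as `P_A ⊗ 1 + (1 - P_A) ⊗ Q_B + (1 - P_A) ⊗ (1 - Q_B)`. The projections `P_A` and
`Q_B` have finite rank, so the first two terms are finite sums of maps factoring through `Y` or `X`;
since these are SCWCG, such maps send conditionally weakly compact sets close to members of a
countable family. There are only countably many pairs `(A, B)`, and a countable family can be merged
into one generating set by shrinking its members (`IsSCWCG.of_approx`). It remains to make the third
term, the corner, uniformly small on a given conditionally weakly compact set `K`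
(`exists_corner_norm_le`).

If every corner exceeds `ε` somewhere on `K`, a gliding hump gives `z_n ∈ K` and disjoint blocks
`C_n`, `D_n` with `‖(P_{C_n} ⊗ Q_{D_n}) z_n‖ > ε`. The lower estimates and Hölder's inequality,
through `1/p + 1/q ≥ 1`, bound `∑ ‖P_{C_n} x‖ ‖Q_{D_n} y‖` by `c d ‖x‖ ‖y‖`, so functionals norming
the blocks at `z_n` define a bounded map into `ℓ¹`. The Schur property of `ℓ¹`
(`WeaklyCauchySeq.exists_norm_apply_le`), applied to a weakly Cauchy subsequence of `z_n`,
contradicts the lower bound `ε`. -/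

theorem WeaklyCauchySeq.comp_strictMono {u : ℕ → Z} (hu : WeaklyCauchySeq 𝕜 u) {s : ℕ → ℕ}
    (hs : StrictMono s) : WeaklyCauchySeq 𝕜 (u ∘ s) := fun φ =>
  (hu φ).comp_tendsto hs.tendsto_atTop

theorem WeaklyCauchySeq.map {u : ℕ → Z} (hu : WeaklyCauchySeq 𝕜 u) (T : Z →L[𝕜] Z') :
    WeaklyCauchySeq 𝕜 (fun n => T (u n)) := fun φ => hu (φ.comp T)

theorem WeaklyCauchySeq.add {u v : ℕ → Z} (hu : WeaklyCauchySeq 𝕜 u)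
    (hv : WeaklyCauchySeq 𝕜 v) : WeaklyCauchySeq 𝕜 (fun n => u n + v n) := fun φ => by
  simp only [map_add]
  exact (hu φ).add (hv φ)

theorem WeaklyCauchySeq.exists_norm_le {u : ℕ → Z} (hu : WeaklyCauchySeq 𝕜 u) :
    ∃ C, ∀ n, ‖u n‖ ≤ C := by
  obtain ⟨C, hC⟩ := banach_steinhaus
    (g := fun n => NormedSpace.inclusionInDoubleDualLi 𝕜 (u n)) fun φ => by
      obtain ⟨R, -, hR⟩ := cauchySeq_bdd (hu φ)
      refine ⟨R + ‖φ (u 0)‖, fun n => ?_⟩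
      have h : ‖φ (u n)‖ ≤ ‖φ (u n) - φ (u 0)‖ + ‖φ (u 0)‖ := by
        simpa using norm_add_le (φ (u n) - φ (u 0)) (φ (u 0))
      have h' := (hR n 0).le
      rw [dist_eq_norm] at h'
      exact h.trans (by gcongr)
  exact ⟨C, fun n => by simpa only [LinearIsometry.norm_map] using hC n⟩

namespace IsConditionallyWeaklyCompact

variable {D D' : Set Z}

theorem image (hD : IsConditionallyWeaklyCompact 𝕜 D) (T : Z →L[𝕜] Z') :
    IsConditionallyWeaklyCompact 𝕜 (T '' D) := by
  intro u hu
  choose v hv hvu using hu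
  obtain ⟨s, hs, hsv⟩ := hD v hv
  refine ⟨s, hs, ?_⟩
  have : u = fun n => T (v n) := funext fun n => (hvu n).symm
  rw [this]
  exact hsv.map T

theorem smul (hD : IsConditionallyWeaklyCompact 𝕜 D) (c : 𝕜) :
    IsConditionallyWeaklyCompact 𝕜 (c • D) :=
  hD.image (c • ContinuousLinearMap.id 𝕜 Z)

theorem add (hD : IsConditionallyWeaklyCompact 𝕜 D)
    (hD' : IsConditionallyWeaklyCompact 𝕜 D') : IsConditionallyWeaklyCompact 𝕜 (D + D') := by
  intro u hu
  choose v hv w hw hvw using hu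
  obtain ⟨s, hs, hsv⟩ := hD v hv
  obtain ⟨t, ht, htw⟩ := hD' (w ∘ s) fun n => hw _
  refine ⟨s ∘ t, hs.comp ht, ?_⟩
  have : u ∘ (s ∘ t) = fun n => (v ∘ s ∘ t) n + ((w ∘ s) ∘ t) n :=
    funext fun n => (hvw _).symm
  rw [this]
  exact (hsv.comp_strictMono ht).add htw

theorem exists_norm_le (hD : IsConditionallyWeaklyCompact 𝕜 D) :
    ∃ C, ∀ x ∈ D, ‖x‖ ≤ C := by
  by_contra! h
  choose u hu hun using fun n : ℕ => h n
  obtain ⟨s, hs, hsu⟩ := hD u hu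
  obtain ⟨C, hC⟩ := hsu.exists_norm_le
  obtain ⟨n, hn⟩ := exists_nat_gt C
  have h1 : (n : ℝ) ≤ s n := by exact_mod_cast hs.id_le n
  exact absurd (hC n) (not_le.2 (hn.trans_le (h1.trans (hun (s n)).le)))

end IsConditionallyWeaklyCompact

theorem WeaklyCauchySeq.of_tendsto {u : ℕ → Z} {x : Z}
    (hu : Filter.Tendsto u Filter.atTop (nhds x)) : WeaklyCauchySeq 𝕜 u := fun φ =>
  ((φ.continuous.tendsto x).comp hu).cauchySeq

/-- The union of a sequence of conditionally weakly compact sets whose sizes tend to zero is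
conditionally weakly compact. -/
theorem IsConditionallyWeaklyCompact.iUnion_of_norm_le {F : ℕ → Set Z}
    (hF : ∀ n, IsConditionallyWeaklyCompact 𝕜 (F n)) {r : ℕ → ℝ}
    (hr : Filter.Tendsto r Filter.atTop (nhds 0)) (hFr : ∀ n, ∀ x ∈ F n, ‖x‖ ≤ r n) :
    IsConditionallyWeaklyCompact 𝕜 (⋃ n, F n) := by
  intro u hu
  choose k hk using fun n => Set.mem_iUnion.1 (hu n)
  -- Either some `F N` contains infinitely many terms, or the indices tend to infinity and `u` tends
  -- to zero in norm.
  by_cases hb : ∃ N, ∃ᶠ n in Filter.atTop, k n = N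
  · obtain ⟨N, hN⟩ := hb
    obtain ⟨s, hs, hsN⟩ := Filter.extraction_of_frequently_atTop hN
    obtain ⟨t, ht, htu⟩ := hF N (u ∘ s) fun n => hsN n ▸ hk (s n)
    exact ⟨s ∘ t, hs.comp ht, htu⟩
  · have hev : ∀ N, ∀ᶠ n in Filter.atTop, k n ≠ N := by simpa using hb
    have hkt : Filter.Tendsto k Filter.atTop Filter.atTop := by
      refine Filter.tendsto_atTop.2 fun N => ?_
      have := (Filter.eventually_all_finset (Finset.range N)).2 fun i _ => hev i
      filter_upwards [this] with n hn
      by_contra! hlt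
      exact hn _ (Finset.mem_range.2 hlt) rfl
    refine ⟨id, strictMono_id, WeaklyCauchySeq.of_tendsto (x := 0) ?_⟩
    exact squeeze_zero_norm (fun n => hFr _ _ (hk n)) (hr.comp hkt)

end WeaklyCauchy

/-! ### Countably generated families -/

section CountablyGenerated

variable {𝕜 : Type*} [RCLike 𝕜] {E Z Z' : Type*} [NormedAddCommGroup Z] [NormedSpace 𝕜 Z]
  [NormedAddCommGroup Z'] [NormedSpace 𝕜 Z'] [NormedAddCommGroup E] [NormedSpace 𝕜 E]

/-- Up to arbitrarily small balls, the images under `T` of all conditionally weakly compact sets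
lie in countably many conditionally weakly compact sets. -/
def HasCountablyGeneratedImages (T : Z →L[𝕜] Z') : Prop :=
  ∃ 𝒢 : Set (Set Z'), 𝒢.Countable ∧ (∀ G ∈ 𝒢, IsConditionallyWeaklyCompact 𝕜 G) ∧
    ∀ K : Set Z, IsConditionallyWeaklyCompact 𝕜 K → ∀ ε : ℝ, 0 < ε →
      ∃ G ∈ 𝒢, T '' K ⊆ G + Metric.closedBall (0 : Z') ε

theorem HasCountablyGeneratedImages.zero :
    HasCountablyGeneratedImages (0 : Z →L[𝕜] Z') := by
  refine ⟨{{0}}, Set.countable_singleton _, ?_, ?_⟩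
  · rintro G rfl u hu
    refine ⟨id, strictMono_id, WeaklyCauchySeq.of_tendsto (x := 0) ?_⟩
    have : u = fun _ => 0 := funext hu
    simp [this]
  · rintro K - ε hε
    refine ⟨{0}, rfl, ?_⟩
    rintro _ ⟨x, -, rfl⟩
    exact ⟨0, rfl, 0, by simpa using hε.le, by simp⟩

theorem HasCountablyGeneratedImages.add {S T : Z →L[𝕜] Z'} (hS : HasCountablyGeneratedImages S)
    (hT : HasCountablyGeneratedImages T) : HasCountablyGeneratedImages (S + T) := by
  obtain ⟨𝒢, hc, hG, hS⟩ := hS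
  obtain ⟨ℋ, hc', hH, hT⟩ := hT
  refine ⟨Set.image2 (· + ·) 𝒢 ℋ, hc.image2 hc' _, ?_, ?_⟩
  · rintro _ ⟨G, hG', H, hH', rfl⟩
    exact (hG G hG').add (hH H hH')
  · intro K hK ε hε
    obtain ⟨G, hG', hGK⟩ := hS K hK (ε / 2) (half_pos hε)
    obtain ⟨H, hH', hHK⟩ := hT K hK (ε / 2) (half_pos hε)
    refine ⟨G + H, ⟨G, hG', H, hH', rfl⟩, ?_⟩
    rintro _ ⟨x, hx, rfl⟩
    obtain ⟨g, hg, a, ha, hga⟩ := hGK ⟨x, hx, rfl⟩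
    obtain ⟨h, hh, b, hb, hhb⟩ := hHK ⟨x, hx, rfl⟩
    refine ⟨g + h, ⟨g, hg, h, hh, rfl⟩, a + b, ?_, ?_⟩
    · rw [mem_closedBall_zero_iff] at *
      linarith [norm_add_le a b]
    · simp only at hga hhb
      simp only [add_apply, ← hga, ← hhb]
      abel

theorem HasCountablyGeneratedImages.sum {ι : Type*} (s : Finset ι) {T : ι → Z →L[𝕜] Z'}
    (hT : ∀ i ∈ s, HasCountablyGeneratedImages (T i)) :
    HasCountablyGeneratedImages (∑ i ∈ s, T i) :=
  Finset.sum_induction _ _ (fun _ _ => HasCountablyGeneratedImages.add)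
    HasCountablyGeneratedImages.zero hT

/-- The set `A '' K` lies near a dilate `nG` of the generating set of `E`, so the countably many
sets `B '' (nG)` suffice. -/
theorem IsSCWCG.hasCountablyGeneratedImages_comp (hE : IsSCWCG 𝕜 E) (B : E →L[𝕜] Z')
    (A : Z →L[𝕜] E) : HasCountablyGeneratedImages (B.comp A) := by
  obtain ⟨G, hG, h⟩ := hE
  refine ⟨Set.range fun n : ℕ => B '' ((n : 𝕜) • G), Set.countable_range _, ?_, ?_⟩
  · rintro _ ⟨n, rfl⟩
    exact (hG.smul _).image B
  · intro K hK ε hε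
    have hB : 0 < ‖B‖ + 1 := by positivity
    obtain ⟨n, -, hn⟩ := h (A '' K) (hK.image A) (ε / (‖B‖ + 1)) (by positivity)
    refine ⟨_, ⟨n, rfl⟩, ?_⟩
    rintro _ ⟨x, hx, rfl⟩
    obtain ⟨g, hg, a, ha, hga⟩ := hn ⟨x, hx, rfl⟩
    refine ⟨B g, ⟨g, hg, rfl⟩, B a, ?_, ?_⟩
    · rw [mem_closedBall_zero_iff] at *
      calc ‖B a‖ ≤ ‖B‖ * ‖a‖ := B.le_opNorm a
        _ ≤ (‖B‖ + 1) * (ε / (‖B‖ + 1)) := by gcongr; linarith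
        _ = ε := by field_simp
    · simp only at hga
      simp [← hga]

/-- A space is SCWCG as soon as countably many maps with countably generated images approximate
the identity uniformly on conditionally weakly compact sets. -/
theorem IsSCWCG.of_approx {ι : Type*} [Countable ι] {T : ι → Z →L[𝕜] Z}
    (hT : ∀ i, HasCountablyGeneratedImages (T i))
    (happ : ∀ K : Set Z, IsConditionallyWeaklyCompact 𝕜 K → ∀ ε : ℝ, 0 < ε →
      ∃ i, ∀ x ∈ K, ‖x - T i x‖ ≤ ε) : IsSCWCG 𝕜 Z := by
  choose 𝒢 hc hG h using hT
  have hcov : ∀ K : Set Z, IsConditionallyWeaklyCompact 𝕜 K → ∀ ε : ℝ, 0 < ε →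
      ∃ G ∈ ⋃ i, 𝒢 i, K ⊆ G + Metric.closedBall (0 : Z) ε := by
    intro K hK ε hε
    obtain ⟨i, hi⟩ := happ K hK (ε / 2) (half_pos hε)
    obtain ⟨G, hGi, hGK⟩ := h i K hK (ε / 2) (half_pos hε)
    refine ⟨G, Set.mem_iUnion.2 ⟨i, hGi⟩, fun x hx => ?_⟩
    obtain ⟨g, hg, a, ha, hga⟩ := hGK ⟨x, hx, rfl⟩
    refine ⟨g, hg, a + (x - T i x), ?_, ?_⟩
    · rw [mem_closedBall_zero_iff] at *
      linarith [norm_add_le a (x - T i x), hi x hx]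
    · simp only at hga ⊢
      rw [← hga]
      abel
  have hne : (⋃ i, 𝒢 i).Nonempty := by
    obtain ⟨G, hG', -⟩ := hcov ∅ (fun u hu => (hu 0).elim) 1 one_pos
    exact ⟨G, hG'⟩
  obtain ⟨F, hF⟩ := (Set.countable_iUnion hc).exists_eq_range hne
  have hFc : ∀ n, IsConditionallyWeaklyCompact 𝕜 (F n) := fun n => by
    obtain ⟨i, hi⟩ := Set.mem_iUnion.1 (hF ▸ Set.mem_range_self n : F n ∈ ⋃ i, 𝒢 i)
    exact hG i _ hi
  choose C hC using fun n => (hFc n).exists_norm_le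
  choose m hm using fun n => exists_nat_gt (C n)
  -- Dividing `F n` by `N n` puts it in the ball of radius `1 / (n + 1)`, so the union of the
  -- shrunken sets stays conditionally weakly compact; multiplying by `N n` recovers `F n`.
  set N : ℕ → ℕ := fun n => (n + 1) * (m n + 1) with hN
  have hN0 : ∀ n, (N n : 𝕜) ≠ 0 := fun n => by
    rw [Nat.cast_ne_zero]
    positivity
  refine ⟨⋃ n, (N n : 𝕜)⁻¹ • F n, ?_, ?_⟩
  · refine IsConditionallyWeaklyCompact.iUnion_of_norm_le (fun n => (hFc n).smul _)
      (tendsto_one_div_add_atTop_nhds_zero_nat (𝕜 := ℝ)) ?_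
    rintro n _ ⟨x, hx, rfl⟩
    have hx' : ‖x‖ ≤ m n + 1 := by linarith [hC n x hx, hm n]
    have : (0 : ℝ) < m n + 1 := by positivity
    simp only [norm_smul, norm_inv, RCLike.norm_natCast, hN]
    push_cast
    calc ((n + 1 : ℝ) * (m n + 1))⁻¹ * ‖x‖ ≤ ((n + 1 : ℝ) * (m n + 1))⁻¹ * (m n + 1) := by gcongr
      _ = 1 / (n + 1) := by field_simp
  · intro K hK ε hε
    obtain ⟨G, hG', hGK⟩ := hcov K hK ε hε
    rw [hF] at hG'
    obtain ⟨n, rfl⟩ := hG'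
    refine ⟨N n, Nat.succ_le_of_lt (by positivity), hGK.trans ?_⟩
    refine Set.add_subset_add_right fun x hx => ?_
    refine ⟨(N n : 𝕜)⁻¹ • x, Set.mem_iUnion.2 ⟨n, x, hx, rfl⟩, ?_⟩
    simp [smul_smul, hN0 n]

end CountablyGenerated

/-! ### A Schur-type lemma -/

section Schur

variable {𝕜 : Type*} [RCLike 𝕜] {Z : Type*} [NormedAddCommGroup Z] [NormedSpace 𝕜 Z]

/-- If `z ↦ (f k z)` is bounded from `Z` to `ℓ¹`, then `f k (z k) → 0` along every weakly Cauchy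
sequence. This is a form of the Schur property of `ℓ¹`. -/
theorem WeaklyCauchySeq.exists_norm_apply_le {z : ℕ → Z} (hz : WeaklyCauchySeq 𝕜 z)
    {f : ℕ → Z →L[𝕜] 𝕜} {M : ℝ}
    (hf : ∀ (n : ℕ) (x : Z), ∑ k ∈ Finset.range n, ‖f k x‖ ≤ M * ‖x‖) {ε : ℝ} (hε : 0 < ε) :
    ∃ k, ‖f k (z k)‖ ≤ ε := by
  have hsum : ∀ x, Summable fun k => ‖f k x‖ := fun x =>
    summable_of_sum_range_le (fun _ => norm_nonneg _) fun n => hf n x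
  -- Each 0-1 sequence `σ` selects a subseries of `∑ f k`, hence a functional `ψ σ`. The index `σ`
  -- ranges over the compact Cantor space, where Baire's theorem makes the Cauchy condition uniform.
  let w : (ℕ → Bool) → ℕ → 𝕜 := fun σ k => if σ k then 1 else 0
  have hw : ∀ σ k x, ‖w σ k * f k x‖ ≤ ‖f k x‖ := fun σ k x => by
    by_cases h : σ k <;> simp [w, h]
  have hwsum : ∀ σ x, Summable fun k => w σ k * f k x := fun σ x =>
    Summable.of_norm_bounded (hsum x) fun k => hw σ k x
  let ψ : (ℕ → Bool) → Z →L[𝕜] 𝕜 := fun σ => LinearMap.mkContinuous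
    { toFun := fun x => ∑' k, w σ k * f k x
      map_add' := fun x y => by
        simp only [map_add, mul_add]
        exact (hwsum σ x).tsum_add (hwsum σ y)
      map_smul' := fun c x => by
        simp only [map_smul, smul_eq_mul, RingHom.id_apply, ← tsum_mul_left]
        exact tsum_congr fun k => by ring } M fun x =>
      (tsum_of_norm_bounded (hsum x).hasSum fun k => hw σ k x).trans
        ((hsum x).tsum_le_of_sum_range_le fun n => hf n x)
  have hψ : ∀ σ x, ψ σ x = ∑' k, w σ k * f k x := fun _ _ => rfl
  have hcont : ∀ x, Continuous fun σ => ψ σ x := fun x => by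
    simp only [hψ]
    refine continuous_tsum (fun k => ?_) (hsum x) fun k σ => hw σ k x
    refine Continuous.mul ?_ continuous_const
    exact (continuous_of_discreteTopology (f := fun b : Bool => if b then (1 : 𝕜) else 0)).comp
      (continuous_apply k)
  let F : ℕ → Set (ℕ → Bool) := fun N =>
    ⋂ i, ⋂ (_ : N ≤ i), {σ | ‖ψ σ (z i) - ψ σ (z N)‖ ≤ ε / 4}
  have hFcl : ∀ N, IsClosed (F N) := fun N => isClosed_iInter fun i => isClosed_iInter fun _ =>
    isClosed_le ((hcont _).sub (hcont _)).norm continuous_const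
  have hFun : ⋃ N, F N = Set.univ := by
    refine Set.eq_univ_of_forall fun σ => ?_
    obtain ⟨N, hN⟩ := Metric.cauchySeq_iff'.1 (hz (ψ σ)) (ε / 4) (by positivity)
    refine Set.mem_iUnion.2 ⟨N, Set.mem_iInter₂.2 fun i hi => ?_⟩
    have := (hN i hi).le
    rwa [dist_eq_norm] at this
  obtain ⟨N, σ, hσ⟩ := nonempty_interior_of_iUnion_of_closed hFcl hFun
  obtain ⟨s, U, hU, hsU⟩ := isOpen_pi_iff.1 isOpen_interior σ hσ
  -- Away from the finite set `s` of coordinates fixed by the basic open set, `σ` may be changed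
  -- freely inside `F N`. Toggling coordinate `k` changes `ψ σ` by exactly `f k`, so the two bounds
  -- `ε / 4` add up to `ε / 2`, for all such `k` at once.
  have hflip : ∀ k ∉ s, ∀ i, N ≤ i → ‖f k (z i) - f k (z N)‖ ≤ ε / 2 := by
    intro k hk i hi
    have key : ∀ b, ‖ψ (Function.update σ k b) (z i - z N)‖ ≤ ε / 4 := fun b => by
      have hmem : Function.update σ k b ∈ F N := by
        refine interior_subset (hsU fun a ha => ?_)
        have : a ≠ k := fun h => hk (h ▸ ha)
        rw [Function.update_of_ne this]
        exact (hU a ha).2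
      have := Set.mem_iInter₂.1 hmem i hi
      rw [map_sub]
      exact this
    have hdiff : ψ (Function.update σ k true) (z i - z N)
        - ψ (Function.update σ k false) (z i - z N) = f k (z i - z N) := by
      rw [hψ, hψ, ← (hwsum _ _).tsum_sub (hwsum _ _), tsum_eq_single k]
      · simp [w]
      · intro j hj
        simp [w, Function.update_of_ne hj]
    rw [← map_sub, ← hdiff]
    linarith [norm_sub_le (ψ (Function.update σ k true) (z i - z N))
      (ψ (Function.update σ k false) (z i - z N)), key true, key false]
  have h0 := (hsum (z N)).tendsto_atTop_zero.eventually (ge_mem_nhds (half_pos hε))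
  have hs : ∀ᶠ k in Filter.atTop, k ∉ s := by
    obtain ⟨m, hm⟩ := s.bddAbove
    filter_upwards [Filter.eventually_gt_atTop m] with k hk hks
    exact absurd (hm hks) (not_le.2 hk)
  -- The condition `N ≤ k` allows the diagonal choice `i = k` in `hflip`.
  obtain ⟨k, hk0, hks, hkN⟩ := (h0.and (hs.and (Filter.eventually_ge_atTop N))).exists
  refine ⟨k, ?_⟩
  have := norm_add_le (f k (z k) - f k (z N)) (f k (z N))
  rw [sub_add_cancel] at this
  linarith [hflip k hks k hkN]

end Schur

/-! ### Maps on the projective tensor product -/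

namespace AlgProjTensor

variable {𝕜 : Type*} [RCLike 𝕜] {X Y E : Type*} [NormedAddCommGroup X] [NormedSpace 𝕜 X]
  [NormedAddCommGroup Y] [NormedSpace 𝕜 Y] [NormedAddCommGroup E] [NormedSpace 𝕜 E]

/-- Elementary tensors. -/
noncomputable def mk : X →ₗ[𝕜] Y →ₗ[𝕜] AlgProjTensor 𝕜 X Y := TensorProduct.mk 𝕜 X Y

@[elab_as_elim]
theorem induction_on {motive : AlgProjTensor 𝕜 X Y → Prop} (z : AlgProjTensor 𝕜 X Y)
    (zero : motive 0) (mk : ∀ x y, motive (mk x y))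
    (add : ∀ a b, motive a → motive b → motive (a + b)) : motive z :=
  TensorProduct.induction_on (R := 𝕜) (M := X) (N := Y) (motive := motive) z zero mk add

/-- The linear map induced by a continuous bilinear map. -/
noncomputable def liftₗ (B : X →L[𝕜] Y →L[𝕜] E) : AlgProjTensor 𝕜 X Y →ₗ[𝕜] E :=
  (TensorProduct.lift (B.toLinearMap₁₂) : X ⊗[𝕜] Y →ₗ[𝕜] E)

@[simp]
theorem liftₗ_mk (B : X →L[𝕜] Y →L[𝕜] E) (x : X) (y : Y) : liftₗ B (mk x y) = B x y := rfl

@[simp]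
theorem evalBilin_mk (B : X →L[𝕜] Y →L[𝕜] 𝕜) (x : X) (y : Y) : evalBilin B (mk x y) = B x y := rfl

theorem evalBilin_smul (c : 𝕜) (S : X →L[𝕜] Y →L[𝕜] 𝕜) (z : AlgProjTensor 𝕜 X Y) :
    evalBilin (c • S) z = c * evalBilin S z := by
  induction z using induction_on with
  | zero => simp
  | mk x y => simp
  | add a b ha hb => rw [map_add, map_add, ha, hb, mul_add]

theorem norm_eq_projNorm (z : AlgProjTensor 𝕜 X Y) : ‖z‖ = projNorm z := rfl

theorem norm_evalBilin_le {S : X →L[𝕜] Y →L[𝕜] 𝕜} {M : ℝ} (hS : ‖S‖ ≤ M)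
    (z : AlgProjTensor 𝕜 X Y) : ‖evalBilin S z‖ ≤ M * ‖z‖ := by
  refine le_of_forall_pos_le_add fun ε hε => ?_
  -- Since `M` may vanish, `S` is normalised by `M + δ` instead.
  obtain ⟨δ, hδ, hδε⟩ : ∃ δ : ℝ, 0 < δ ∧ δ * ‖z‖ ≤ ε :=
    ⟨ε / (‖z‖ + 1), by positivity, by
      rw [div_mul_eq_mul_div, div_le_iff₀ (by positivity)]
      gcongr
      linarith⟩
  have hM : 0 < M + δ := by linarith [norm_nonneg S]
  have hn : ‖((M + δ : ℝ) : 𝕜)⁻¹‖ = (M + δ)⁻¹ := by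
    rw [norm_inv, RCLike.norm_ofReal, abs_of_pos hM]
  have h := norm_evalBilin_le_projNorm (((M + δ : ℝ) : 𝕜)⁻¹ • S)
    ((ContinuousLinearMap.opNorm_smul_le _ S).trans (by
      rw [hn, inv_mul_le_iff₀ hM]
      linarith)) z
  rw [evalBilin_smul, norm_mul, hn, inv_mul_le_iff₀ hM, ← norm_eq_projNorm] at h
  linarith

theorem norm_mk_le (x : X) (y : Y) : ‖mk (𝕜 := 𝕜) x y‖ ≤ ‖x‖ * ‖y‖ :=
  projNorm_le fun S hS => by
    rw [evalBilin_mk]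
    calc ‖S x y‖ ≤ ‖S‖ * ‖x‖ * ‖y‖ := S.le_opNorm₂ x y
      _ ≤ 1 * ‖x‖ * ‖y‖ := by gcongr
      _ = ‖x‖ * ‖y‖ := by ring

/-- Composing with functionals on `E` reduces the vector-valued bound to scalar bilinear forms,
which define the norm. -/
theorem norm_liftₗ_le (B : X →L[𝕜] Y →L[𝕜] E) (z : AlgProjTensor 𝕜 X Y) :
    ‖liftₗ B z‖ ≤ ‖B‖ * ‖z‖ := by
  refine NormedSpace.norm_le_dual_bound 𝕜 _ (by positivity) fun φ => ?_
  have h : φ (liftₗ B z) = evalBilin ((ContinuousLinearMap.compL 𝕜 Y E 𝕜 φ).comp B) z := by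
    induction z using induction_on with
    | zero => simp
    | mk x y => simp
    | add a b ha hb => rw [map_add, map_add, map_add, ha, hb]
  rw [h]
  refine (norm_evalBilin_le (M := ‖φ‖ * ‖B‖) ?_ z).trans (by ring_nf; rfl)
  refine ContinuousLinearMap.opNorm_le_bound₂ _ (by positivity) fun x y => ?_
  calc ‖φ (B x y)‖ ≤ ‖φ‖ * ‖B x y‖ := φ.le_opNorm _
    _ ≤ ‖φ‖ * (‖B‖ * ‖x‖ * ‖y‖) := by gcongr; exact B.le_opNorm₂ x y
    _ = ‖φ‖ * ‖B‖ * ‖x‖ * ‖y‖ := by ring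

end AlgProjTensor

namespace ProjectiveTensorProduct

variable {𝕜 : Type*} [RCLike 𝕜] {X Y E : Type*} [NormedAddCommGroup X] [NormedSpace 𝕜 X]
  [NormedAddCommGroup Y] [NormedSpace 𝕜 Y] [NormedAddCommGroup E] [NormedSpace 𝕜 E]

/-- The elementary tensors, as a continuous bilinear map. -/
noncomputable def tmul : X →L[𝕜] Y →L[𝕜] ProjectiveTensorProduct 𝕜 X Y :=
  LinearMap.mkContinuous₂ (AlgProjTensor.mk.compr₂
    (UniformSpace.Completion.toComplL (𝕜 := 𝕜) (E := AlgProjTensor 𝕜 X Y)).toLinearMap) 1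
    fun x y => by
      rw [one_mul]
      exact (UniformSpace.Completion.norm_coe _).trans_le (AlgProjTensor.norm_mk_le x y)

theorem norm_tmul_le (x : X) (y : Y) : ‖tmul (𝕜 := 𝕜) x y‖ ≤ ‖x‖ * ‖y‖ :=
  (UniformSpace.Completion.norm_coe _).trans_le (AlgProjTensor.norm_mk_le x y)

@[elab_as_elim]
theorem dense_induction {motive : ProjectiveTensorProduct 𝕜 X Y → Prop}
    (z : ProjectiveTensorProduct 𝕜 X Y) (closed : IsClosed {z | motive z}) (zero : motive 0)
    (tmul : ∀ x y, motive (tmul x y)) (add : ∀ a b, motive a → motive b → motive (a + b)) :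
    motive z := by
  refine UniformSpace.Completion.induction_on z closed fun a => ?_
  induction a using AlgProjTensor.induction_on with
  | zero => exact zero
  | mk x y => exact tmul x y
  | add a b ha hb =>
    rw [UniformSpace.Completion.coe_add]
    exact add _ _ ha hb

theorem hom_ext {S T : ProjectiveTensorProduct 𝕜 X Y →L[𝕜] E}
    (h : ∀ x y, S (tmul x y) = T (tmul x y)) : S = T := by
  ext z
  refine dense_induction z (isClosed_eq S.continuous T.continuous) (by simp) h fun a b ha hb => ?_
  rw [map_add, map_add, ha, hb]

variable [CompleteSpace E]

/-- The continuous linear map on the projective tensor product induced by a continuous bilinear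
map. -/
noncomputable def lift (B : X →L[𝕜] Y →L[𝕜] E) : ProjectiveTensorProduct 𝕜 X Y →L[𝕜] E :=
  ((AlgProjTensor.liftₗ B).mkContinuous ‖B‖ (AlgProjTensor.norm_liftₗ_le B)).extend
    (UniformSpace.Completion.toComplL (𝕜 := 𝕜) (E := AlgProjTensor 𝕜 X Y))

theorem lift_coe (B : X →L[𝕜] Y →L[𝕜] E) (z : AlgProjTensor 𝕜 X Y) :
    lift B (z : ProjectiveTensorProduct 𝕜 X Y) = AlgProjTensor.liftₗ B z :=
  ContinuousLinearMap.extend_eq _ UniformSpace.Completion.denseRange_coe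
    (UniformSpace.Completion.isUniformInducing_coe _) z

@[simp]
theorem lift_tmul (B : X →L[𝕜] Y →L[𝕜] E) (x : X) (y : Y) : lift B (tmul x y) = B x y :=
  lift_coe B (AlgProjTensor.mk x y)

theorem norm_lift_le (B : X →L[𝕜] Y →L[𝕜] E) : ‖lift B‖ ≤ ‖B‖ := by
  refine ContinuousLinearMap.opNorm_le_bound _ (norm_nonneg B) fun z => ?_
  refine UniformSpace.Completion.induction_on z
    (isClosed_le (lift B).continuous.norm (continuous_const.mul continuous_norm)) fun a => ?_
  rw [lift_coe, UniformSpace.Completion.norm_coe]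
  exact AlgProjTensor.norm_liftₗ_le B a

/-- A functional is bounded by `M` if it is so on elementary tensors. -/
theorem norm_apply_le_of_tmul (φ : ProjectiveTensorProduct 𝕜 X Y →L[𝕜] E) {M : ℝ} (hM : 0 ≤ M)
    (h : ∀ x y, ‖φ (tmul x y)‖ ≤ M * ‖x‖ * ‖y‖) (z : ProjectiveTensorProduct 𝕜 X Y) :
    ‖φ z‖ ≤ M * ‖z‖ := by
  have hφ : φ = lift ((ContinuousLinearMap.compL 𝕜 Y _ E φ).comp tmul) := hom_ext fun x y => by
    simp
  rw [hφ]
  refine ContinuousLinearMap.le_of_opNorm_le _ ((norm_lift_le _).trans ?_) z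
  exact ContinuousLinearMap.opNorm_le_bound₂ _ hM h

variable {X' Y' : Type*} [NormedAddCommGroup X'] [NormedSpace 𝕜 X']
  [NormedAddCommGroup Y'] [NormedSpace 𝕜 Y']

/-- The tensor product of two continuous linear maps. -/
noncomputable def map (S : X →L[𝕜] X') (T : Y →L[𝕜] Y') :
    ProjectiveTensorProduct 𝕜 X Y →L[𝕜] ProjectiveTensorProduct 𝕜 X' Y' :=
  lift (tmul.bilinearComp S T)

@[simp]
theorem map_tmul (S : X →L[𝕜] X') (T : Y →L[𝕜] Y') (x : X) (y : Y) :
    map S T (tmul x y) = tmul (S x) (T y) := by simp [map]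

theorem norm_map_apply_le {S : X →L[𝕜] X'} {T : Y →L[𝕜] Y'} {a b : ℝ} (hS : ‖S‖ ≤ a)
    (hT : ‖T‖ ≤ b) (z : ProjectiveTensorProduct 𝕜 X Y) : ‖map S T z‖ ≤ a * b * ‖z‖ := by
  have ha := (norm_nonneg S).trans hS
  have hb := (norm_nonneg T).trans hT
  refine norm_apply_le_of_tmul _ (by positivity) (fun x y => ?_) z
  rw [map_tmul]
  calc _ ≤ ‖S x‖ * ‖T y‖ := norm_tmul_le _ _
    _ ≤ (a * ‖x‖) * (b * ‖y‖) := by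
      gcongr
      exacts [S.le_of_opNorm_le hS x, T.le_of_opNorm_le hT y]
    _ = a * b * ‖x‖ * ‖y‖ := by ring

theorem map_map {X'' Y'' : Type*} [NormedAddCommGroup X''] [NormedSpace 𝕜 X'']
    [NormedAddCommGroup Y''] [NormedSpace 𝕜 Y''] (S' : X' →L[𝕜] X'') (T' : Y' →L[𝕜] Y'')
    (S : X →L[𝕜] X') (T : Y →L[𝕜] Y') (z : ProjectiveTensorProduct 𝕜 X Y) :
    map S' T' (map S T z) = map (S'.comp S) (T'.comp T) z :=
  DFunLike.congr_fun
    (hom_ext (S := (map S' T').comp (map S T)) (T := map (S'.comp S) (T'.comp T)) (by simp)) z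

theorem map_id : map (.id 𝕜 X) (.id 𝕜 Y) = .id 𝕜 (ProjectiveTensorProduct 𝕜 X Y) :=
  hom_ext (by simp)

theorem map_sub_left (S S' : X →L[𝕜] X') (T : Y →L[𝕜] Y') :
    map (S - S') T = map S T - map S' T :=
  hom_ext (by simp)

theorem map_sub_right (S : X →L[𝕜] X') (T T' : Y →L[𝕜] Y') :
    map S (T - T') = map S T - map S T' :=
  hom_ext (by simp)

theorem map_sum_left {ι : Type*} (s : Finset ι) (S : ι → X →L[𝕜] X') (T : Y →L[𝕜] Y') :
    map (∑ i ∈ s, S i) T = ∑ i ∈ s, map (S i) T :=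
  hom_ext (by simp)

theorem map_sum_right {ι : Type*} (s : Finset ι) (S : X →L[𝕜] X') (T : ι → Y →L[𝕜] Y') :
    map S (∑ i ∈ s, T i) = ∑ i ∈ s, map S (T i) :=
  hom_ext (by simp)

/-- A rank-one left factor makes the map factor through `Y`: first `x ⊗ y ↦ φ x • T y`, then `y ↦ e
⊗ y`. -/
theorem hasCountablyGeneratedImages_map_smulRight_left [CompleteSpace Y] (hY : IsSCWCG 𝕜 Y)
    (φ : X →L[𝕜] 𝕜) (e : X) (T : Y →L[𝕜] Y) :
    HasCountablyGeneratedImages (map (φ.smulRight e) T) := by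
  have : map (φ.smulRight e) T = (tmul e).comp
      (lift ((ContinuousLinearMap.lsmul 𝕜 𝕜 : 𝕜 →L[𝕜] Y →L[𝕜] Y).bilinearComp φ T)) :=
    hom_ext (by simp)
  rw [this]
  exact hY.hasCountablyGeneratedImages_comp _ _

theorem hasCountablyGeneratedImages_map_smulRight_right [CompleteSpace X] (hX : IsSCWCG 𝕜 X)
    (S : X →L[𝕜] X) (φ : Y →L[𝕜] 𝕜) (e : Y) :
    HasCountablyGeneratedImages (map S (φ.smulRight e)) := by
  have : map S (φ.smulRight e) = (tmul.flip e).comp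
      (lift ((ContinuousLinearMap.lsmul 𝕜 𝕜 : 𝕜 →L[𝕜] X →L[𝕜] X).bilinearComp φ S).flip) :=
    hom_ext (by simp)
  rw [this]
  exact hX.hasCountablyGeneratedImages_comp _ _

end ProjectiveTensorProduct

/-! ### Projections of an unconditional decomposition -/

namespace IsUnconditionalSchauderDecomposition

variable {𝕜 : Type*} [RCLike 𝕜] {X : Type*} [NormedAddCommGroup X] [NormedSpace 𝕜 X]
  {I : Type*} {V : I → Submodule 𝕜 X} (h : IsUnconditionalSchauderDecomposition V)

theorem proj_eq {f : I → X} {x : X} (hf : ∀ i, f i ∈ V i) (hx : HasSum f x) (i : I) :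
    h.proj i x = f i :=
  congrFun ((h.existsUnique x).unique (h.existsUnique x).choose_spec.1 ⟨hf, hx⟩) i

theorem proj_add (i : I) (x y : X) : h.proj i (x + y) = h.proj i x + h.proj i y :=
  h.proj_eq (f := fun i => h.proj i x + h.proj i y)
    (fun i => (V i).add_mem (h.proj_mem i x) (h.proj_mem i y))
    ((h.hasSum_proj x).add (h.hasSum_proj y)) i

theorem proj_smul (i : I) (c : 𝕜) (x : X) : h.proj i (c • x) = c • h.proj i x :=
  h.proj_eq (f := fun i => c • h.proj i x) (fun i => (V i).smul_mem c (h.proj_mem i x))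
    ((h.hasSum_proj x).const_smul c) i

open Classical in
theorem proj_of_mem {i : I} {x : X} (hx : x ∈ V i) (j : I) :
    h.proj j x = if j = i then x else 0 := by
  refine h.proj_eq (f := fun j => if j = i then x else 0) (fun j => ?_) (hasSum_ite_eq i x) j
  by_cases hj : j = i
  · subst hj
    simpa using hx
  · simp [hj]

/-- The lower estimate for a single block; it makes the projections continuous and uniformly
bounded. -/
theorem norm_finProj_le {c p : ℝ} (hp : 0 < p)
    (hc : ∀ (r : ℕ) (C : Fin r → Finset I), (∀ k l, k ≠ l → Disjoint (C k) (C l)) →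
      ∀ x : X, (∑ k, ‖h.finProj (C k) x‖ ^ p) ^ (1 / p) ≤ c * ‖x‖) (C : Finset I) (x : X) :
    ‖h.finProj C x‖ ≤ c * ‖x‖ := by
  have := hc 1 (fun _ => C) (fun k l hkl => (hkl (Subsingleton.elim k l)).elim) x
  rwa [Fin.sum_univ_one, one_div, Real.rpow_rpow_inv (norm_nonneg _) hp.ne'] at this

variable {c : ℝ} (hc : ∀ (C : Finset I) (x : X), ‖h.finProj C x‖ ≤ c * ‖x‖)

/-- The projection `P_i` as a continuous linear map. -/
noncomputable def projL (i : I) : X →L[𝕜] X :=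
  LinearMap.mkContinuous
    { toFun := h.proj i
      map_add' := h.proj_add i
      map_smul' := h.proj_smul i } c fun x => by simpa [finProj] using hc {i} x

/-- The projection `P_C` as a continuous linear map. -/
noncomputable def finProjL (C : Finset I) : X →L[𝕜] X := ∑ i ∈ C, h.projL hc i

theorem finProjL_apply (C : Finset I) (x : X) : h.finProjL hc C x = h.finProj C x := by
  simp [finProjL, finProj, projL]

theorem norm_finProjL_le (hc0 : 0 ≤ c) (C : Finset I) : ‖h.finProjL hc C‖ ≤ c :=
  ContinuousLinearMap.opNorm_le_bound _ hc0 fun x => by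
    rw [finProjL_apply]
    exact hc C x

theorem finProjL_comp_of_subset {A B : Finset I} (hAB : A ⊆ B) :
    (h.finProjL hc A).comp (h.finProjL hc B) = h.finProjL hc A := by
  classical
  ext x
  rw [ContinuousLinearMap.comp_apply, finProjL_apply h hc B]
  simp only [finProj, map_sum]
  simp only [finProjL_apply, finProj]
  rw [Finset.sum_comm]
  refine Finset.sum_congr rfl fun i hi => ?_
  simp only [fun j => h.proj_of_mem (h.proj_mem j x) i]
  simp [hAB hi]

theorem finProjL_sdiff [DecidableEq I] {A B : Finset I} (hAB : A ⊆ B) :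
    h.finProjL hc (B \ A) = h.finProjL hc B - h.finProjL hc A := by
  rw [finProjL, finProjL, finProjL, ← Finset.sum_sdiff hAB, add_sub_cancel_right]

theorem tendsto_finProjL (x : X) :
    Filter.Tendsto (fun C => h.finProjL hc C x) Filter.atTop (nhds x) := by
  simp only [finProjL_apply]
  exact h.hasSum_proj x

/-- The projection onto a finite-dimensional summand is a finite sum of rank-one maps. -/
theorem exists_projL_eq_sum_smulRight (i : I) [FiniteDimensional 𝕜 (V i)] :
    ∃ (n : ℕ) (φ : Fin n → X →L[𝕜] 𝕜) (e : Fin n → X),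
      h.projL hc i = ∑ k, (φ k).smulRight (e k) := by
  let b := Module.finBasis 𝕜 (V i)
  let R : X →L[𝕜] V i := (h.projL hc i).codRestrict (V i) fun x => h.proj_mem i x
  refine ⟨_, fun k => (LinearMap.toContinuousLinearMap (b.coord k)).comp R, fun k => b k, ?_⟩
  ext x
  have := congrArg Subtype.val (b.sum_repr (R x))
  simp only [Submodule.coe_sum, Submodule.coe_smul] at this
  rw [sum_apply]
  exact this.symm

end IsUnconditionalSchauderDecomposition

/-! ### Block-diagonal estimates -/

/-- With `B` the `ℓ^q` norm, each `b i ≤ B`, so `b i ^ r ≤ b i ^ q * B ^ (r - q)`; then sum. -/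
theorem sum_rpow_rpow_inv_le_of_exponent_le {ι : Type*} (s : Finset ι) {b : ι → ℝ}
    (hb : ∀ i ∈ s, 0 ≤ b i) {q r : ℝ} (hq : 0 < q) (hqr : q ≤ r) :
    (∑ i ∈ s, b i ^ r) ^ (1 / r) ≤ (∑ i ∈ s, b i ^ q) ^ (1 / q) := by
  have hr : 0 < r := hq.trans_le hqr
  set S := ∑ i ∈ s, b i ^ q
  have hS : 0 ≤ S := Finset.sum_nonneg fun i hi => Real.rpow_nonneg (hb i hi) q
  set B := S ^ (1 / q)
  have hB : 0 ≤ B := Real.rpow_nonneg hS _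
  have hBq : B ^ q = S := by rw [← Real.rpow_mul hS, one_div_mul_cancel hq.ne', Real.rpow_one]
  have hbB : ∀ i ∈ s, b i ≤ B := fun i hi => by
    rw [← Real.rpow_le_rpow_iff (hb i hi) hB hq, hBq]
    exact Finset.single_le_sum (f := fun i => b i ^ q)
      (fun j hj => Real.rpow_nonneg (hb j hj) q) hi
  have key : ∑ i ∈ s, b i ^ r ≤ B ^ r := by
    calc ∑ i ∈ s, b i ^ r ≤ ∑ i ∈ s, b i ^ q * B ^ (r - q) := by
          refine Finset.sum_le_sum fun i hi => ?_
          have : b i ^ r = b i ^ q * b i ^ (r - q) := by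
            rw [← Real.rpow_add_of_nonneg (hb i hi) hq.le (sub_nonneg.2 hqr), add_sub_cancel]
          rw [this]
          exact mul_le_mul_of_nonneg_left
            (Real.rpow_le_rpow (hb i hi) (hbB i hi) (sub_nonneg.2 hqr))
            (Real.rpow_nonneg (hb i hi) q)
      _ = B ^ q * B ^ (r - q) := by rw [← Finset.sum_mul, hBq]
      _ = B ^ r := by
        rw [← Real.rpow_add_of_nonneg hB hq.le (sub_nonneg.2 hqr), add_sub_cancel]
  calc (∑ i ∈ s, b i ^ r) ^ (1 / r) ≤ (B ^ r) ^ (1 / r) :=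
        Real.rpow_le_rpow (Finset.sum_nonneg fun i hi => Real.rpow_nonneg (hb i hi) r) key
          (by positivity)
    _ = B := by rw [← Real.rpow_mul hB, mul_one_div_cancel hr.ne', Real.rpow_one]

/-- Hölder with the conjugate exponent `p'` of `p`: the hypothesis says `q ≤ p'`, so the `ℓ^{p'}`
norm of `b` is at most its `ℓ^q` norm. -/
theorem sum_mul_le_of_one_le_inv_add_inv {ι : Type*} (s : Finset ι) {a b : ι → ℝ}
    (ha : ∀ i ∈ s, 0 ≤ a i) (hb : ∀ i ∈ s, 0 ≤ b i) {p q : ℝ} (hp : 1 < p) (hq : 0 < q)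
    (hpq : 1 ≤ 1 / p + 1 / q) :
    ∑ i ∈ s, a i * b i ≤ (∑ i ∈ s, a i ^ p) ^ (1 / p) * (∑ i ∈ s, b i ^ q) ^ (1 / q) := by
  have hconj := Real.HolderConjugate.conjExponent hp
  refine (Real.inner_le_Lp_mul_Lq_of_nonneg s hconj ha hb).trans ?_
  refine mul_le_mul_of_nonneg_left (sum_rpow_rpow_inv_le_of_exponent_le s hb hq ?_)
    (Real.rpow_nonneg (Finset.sum_nonneg fun i hi => Real.rpow_nonneg (ha i hi) p) _)
  have h1 := hconj.inv_add_inv_eq_one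
  have h2 : (Real.conjExponent p)⁻¹ ≤ q⁻¹ := by
    rw [one_div, one_div] at hpq
    linarith
  exact (inv_le_inv₀ hconj.symm.pos hq).1 h2

namespace ProjectiveTensorProduct

variable {𝕜 : Type*} [RCLike 𝕜] {X Y : Type*} [NormedAddCommGroup X] [NormedSpace 𝕜 X]
  [NormedAddCommGroup Y] [NormedSpace 𝕜 Y]

/-- Unimodular factors adapted to `z` turn the sum of absolute values into the value of one
functional, whose bound can be tested on elementary tensors. -/
theorem sum_norm_apply_le_of_tmul {ι : Type*} (s : Finset ι)
    (f : ι → ProjectiveTensorProduct 𝕜 X Y →L[𝕜] 𝕜) {M : ℝ} (hM : 0 ≤ M)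
    (h : ∀ x y, ∑ i ∈ s, ‖f i (tmul x y)‖ ≤ M * ‖x‖ * ‖y‖) (z : ProjectiveTensorProduct 𝕜 X Y) :
    ∑ i ∈ s, ‖f i z‖ ≤ M * ‖z‖ := by
  choose u hu huz using fun i => RCLike.exists_norm_eq_mul_self (f i z)
  have hz : (∑ i ∈ s, u i • f i) z = ((∑ i ∈ s, ‖f i z‖ : ℝ) : 𝕜) := by
    simp [huz]
  have hle := norm_apply_le_of_tmul (∑ i ∈ s, u i • f i) hM (fun x y => ?_) z
  · rw [hz, RCLike.norm_ofReal] at hle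
    exact (le_abs_self _).trans hle
  · refine le_trans ?_ (h x y)
    simp only [sum_apply, smul_apply]
    refine (norm_sum_le _ _).trans_eq (Finset.sum_congr rfl fun i _ => ?_)
    rw [norm_smul, hu, one_mul]

/-- Uniform boundedness gives equicontinuity, so the set of points of convergence is closed and
elementary tensors suffice. -/
theorem tendsto_map_apply {α : Type*} {l : Filter α} {S : α → X →L[𝕜] X} {T : α → Y →L[𝕜] Y}
    {a b : ℝ} (hS : ∀ i, ‖S i‖ ≤ a) (hT : ∀ i, ‖T i‖ ≤ b)
    (hSl : ∀ x, Filter.Tendsto (fun i => S i x) l (nhds x))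
    (hTl : ∀ y, Filter.Tendsto (fun i => T i y) l (nhds y)) (z : ProjectiveTensorProduct 𝕜 X Y) :
    Filter.Tendsto (fun i => map (S i) (T i) z) l (nhds z) := by
  have heq : Equicontinuous fun (i : α) (z : ProjectiveTensorProduct 𝕜 X Y) =>
      map (S i) (T i) z := by
    refine (LipschitzWith.uniformEquicontinuous _ (a * b).toNNReal fun i => ?_).equicontinuous
    refine LipschitzWith.of_dist_le_mul fun z w => ?_
    rw [dist_eq_norm, dist_eq_norm, ← map_sub]
    refine (norm_map_apply_le (hS i) (hT i) _).trans ?_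
    gcongr
    exact Real.le_coe_toNNReal _
  induction z using dense_induction with
  | closed => exact heq.isClosed_setOfPred_tendsto continuous_id
  | zero =>
    simp only [map_zero]
    exact tendsto_const_nhds
  | tmul x y =>
    simp only [map_tmul]
    have h : Filter.Tendsto (fun w : X × Y => tmul (𝕜 := 𝕜) w.1 w.2) (nhds (x, y))
        (nhds (tmul x y)) :=
      (by fun_prop : Continuous fun w : X × Y => tmul (𝕜 := 𝕜) w.1 w.2).tendsto (x, y)
    have h' := h.comp ((hSl x).prodMk_nhds (hTl y))
    exact h'
  | add z w hz hw =>
    simp only [map_add]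
    exact hz.add hw

end ProjectiveTensorProduct

/-! ### Corners of conditionally weakly compact sets -/

theorem disjoint_sdiff_comp_of_monotone {ι : Type*} [DecidableEq ι] {f : ℕ → Finset ι}
    (hf : Monotone f) {s : ℕ → ℕ} (hs : StrictMono s) (k l : ℕ) (hkl : k ≠ l) :
    Disjoint (f (s k + 1) \ f (s k)) (f (s l + 1) \ f (s l)) := by
  have key : ∀ k l, k < l →
      Disjoint (f (s k + 1) \ f (s k)) (f (s l + 1) \ f (s l)) := fun k l hkl =>
    Finset.disjoint_sdiff.mono_left (Finset.sdiff_subset.trans (hf (hs hkl)))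
  rcases hkl.lt_or_gt with h | h
  · exact key k l h
  · exact (key l k h).symm

section Corner

open ProjectiveTensorProduct

variable {𝕜 : Type*} [RCLike 𝕜]
  {X : Type*} [NormedAddCommGroup X] [NormedSpace 𝕜 X]
  {Y : Type*} [NormedAddCommGroup Y] [NormedSpace 𝕜 Y]
  {I : Type*} {J : Type*}
  {V : I → Submodule 𝕜 X} (hV : IsUnconditionalSchauderDecomposition V)
  {W : J → Submodule 𝕜 Y} (hW : IsUnconditionalSchauderDecomposition W)
  {p q c d : ℝ}

/-- Disjoint blocks of the two decompositions pair up in `ℓ¹`. -/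
theorem sum_norm_finProj_mul_norm_finProj_le (hp : 1 < p) (hq : 0 < q)
    (hpq : 1 ≤ 1 / p + 1 / q) (hc0 : 0 ≤ c)
    (hc : ∀ (r : ℕ) (C : Fin r → Finset I), (∀ k l, k ≠ l → Disjoint (C k) (C l)) →
      ∀ x : X, (∑ k, ‖hV.finProj (C k) x‖ ^ p) ^ (1 / p) ≤ c * ‖x‖)
    (hd : ∀ (r : ℕ) (D : Fin r → Finset J), (∀ k l, k ≠ l → Disjoint (D k) (D l)) →
      ∀ y : Y, (∑ k, ‖hW.finProj (D k) y‖ ^ q) ^ (1 / q) ≤ d * ‖y‖)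
    {C : ℕ → Finset I} {D : ℕ → Finset J} (hC : ∀ k l, k ≠ l → Disjoint (C k) (C l))
    (hD : ∀ k l, k ≠ l → Disjoint (D k) (D l)) (n : ℕ) (x : X) (y : Y) :
    ∑ k ∈ Finset.range n, ‖hV.finProj (C k) x‖ * ‖hW.finProj (D k) y‖
      ≤ c * d * ‖x‖ * ‖y‖ := by
  refine (sum_mul_le_of_one_le_inv_add_inv _ (fun _ _ => norm_nonneg _) (fun _ _ => norm_nonneg _)
    hp hq hpq).trans ?_
  rw [Finset.sum_range, Finset.sum_range]
  calc _ ≤ (c * ‖x‖) * (d * ‖y‖) :=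
        mul_le_mul
          (hc n (fun k => C k) (fun k l hkl => hC _ _ (Fin.val_injective.ne hkl)) x)
          (hd n (fun k => D k) (fun k l hkl => hD _ _ (Fin.val_injective.ne hkl)) y)
          (by positivity) (by positivity)
    _ = _ := by ring

/-- On a conditionally weakly compact subset of the projective tensor product, the corners
`(1 - P_A) ⊗ (1 - Q_B)` are uniformly small. -/
theorem exists_corner_norm_le (hp : 1 < p) (hq : 0 < q) (hpq : 1 ≤ 1 / p + 1 / q)
    (hc0 : 0 ≤ c) (hd0 : 0 ≤ d)
    (hc : ∀ (r : ℕ) (C : Fin r → Finset I), (∀ k l, k ≠ l → Disjoint (C k) (C l)) →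
      ∀ x : X, (∑ k, ‖hV.finProj (C k) x‖ ^ p) ^ (1 / p) ≤ c * ‖x‖)
    (hd : ∀ (r : ℕ) (D : Fin r → Finset J), (∀ k l, k ≠ l → Disjoint (D k) (D l)) →
      ∀ y : Y, (∑ k, ‖hW.finProj (D k) y‖ ^ q) ^ (1 / q) ≤ d * ‖y‖)
    (hc' : ∀ (C : Finset I) (x : X), ‖hV.finProj C x‖ ≤ c * ‖x‖)
    (hd' : ∀ (D : Finset J) (y : Y), ‖hW.finProj D y‖ ≤ d * ‖y‖)
    {K : Set (ProjectiveTensorProduct 𝕜 X Y)} (hK : IsConditionallyWeaklyCompact 𝕜 K)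
    {ε : ℝ} (hε : 0 < ε) :
    ∃ (A : Finset I) (B : Finset J), ∀ z ∈ K,
      ‖map (.id 𝕜 X - hV.finProjL hc' A) (.id 𝕜 Y - hW.finProjL hd' B) z‖ ≤ ε := by
  classical
  by_contra! hcon
  set P := hV.finProjL hc'
  set Q := hW.finProjL hd'
  -- As `(P_{b.1} ⊗ Q_{b.2}) z → z`, a large corner at `z` is already visible on a finite block,
  -- because `(1 - P_A) P_{b.1} = P_{b.1 \ A}` when `A ⊆ b.1`.
  have step : ∀ a : Finset I × Finset J, ∃ (z : ProjectiveTensorProduct 𝕜 X Y)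
      (b : Finset I × Finset J), z ∈ K ∧ a ≤ b ∧
        ε < ‖map (P (b.1 \ a.1)) (Q (b.2 \ a.2)) z‖ := by
    rintro ⟨A, B⟩
    obtain ⟨z, hz, hεz⟩ := hcon A B
    have ht := tendsto_map_apply (l := Filter.atTop) (S := fun b : Finset I × Finset J => P b.1)
      (T := fun b => Q b.2) (fun b => hV.norm_finProjL_le hc' hc0 b.1)
      (fun b => hW.norm_finProjL_le hd' hd0 b.2)
      (fun x => (hV.tendsto_finProjL hc' x).comp
        (Filter.prod_atTop_atTop_eq (α := Finset I) (β := Finset J) ▸ Filter.tendsto_fst))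
      (fun y => (hW.tendsto_finProjL hd' y).comp
        (Filter.prod_atTop_atTop_eq (α := Finset I) (β := Finset J) ▸ Filter.tendsto_snd)) z
    have ht' := ((map (.id 𝕜 X - P A) (.id 𝕜 Y - Q B)).continuous.tendsto z).comp ht
    obtain ⟨b, hb, hab⟩ := ((ht'.norm.eventually (lt_mem_nhds hεz)).and
      (Filter.eventually_ge_atTop (A, B))).exists
    refine ⟨z, b, hz, hab, ?_⟩
    have hA : A ⊆ b.1 := hab.1
    have hB : B ⊆ b.2 := hab.2
    have h1 : (ContinuousLinearMap.id 𝕜 X - P A).comp (P b.1) = P (b.1 \ A) := by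
      rw [ContinuousLinearMap.sub_comp, ContinuousLinearMap.id_comp,
        hV.finProjL_comp_of_subset hc' hA]
      exact (hV.finProjL_sdiff hc' hA).symm
    have h2 : (ContinuousLinearMap.id 𝕜 Y - Q B).comp (Q b.2) = Q (b.2 \ B) := by
      rw [ContinuousLinearMap.sub_comp, ContinuousLinearMap.id_comp,
        hW.finProjL_comp_of_subset hd' hB]
      exact (hW.finProjL_sdiff hd' hB).symm
    simpa only [Function.comp_apply, map_map, h1, h2] using hb
  choose ζ β hζ hβ hεζ using step
  let a : ℕ → Finset I × Finset J := fun n => β^[n] (∅, ∅)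
  have ha : ∀ n, a (n + 1) = β (a n) := fun n => Function.iterate_succ_apply' β n _
  have hmono : Monotone a := monotone_nat_of_le_succ fun n => (ha n).symm ▸ hβ (a n)
  obtain ⟨s, hs, hsz⟩ := hK (fun n => ζ (a n)) fun n => hζ _
  have hC := disjoint_sdiff_comp_of_monotone (f := fun n => (a n).1) (fun _ _ h => (hmono h).1) hs
  have hD := disjoint_sdiff_comp_of_monotone (f := fun n => (a n).2) (fun _ _ h => (hmono h).2) hs
  -- The blocks end at `s k + 1`, not at `s (k + 1)`: these are the ones on which `step` gives the
  -- lower bound, and they remain disjoint along the subsequence.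
  let R : ℕ → ProjectiveTensorProduct 𝕜 X Y →L[𝕜] ProjectiveTensorProduct 𝕜 X Y := fun k =>
    map (P ((a (s k + 1)).1 \ (a (s k)).1)) (Q ((a (s k + 1)).2 \ (a (s k)).2))
  choose φ hφ hφR using fun k => exists_dual_vector'' 𝕜 (R k (ζ (a (s k))))
  obtain ⟨k, hk⟩ := hsz.exists_norm_apply_le (f := fun k => (φ k).comp (R k)) (M := c * d)
    (fun n z => sum_norm_apply_le_of_tmul _ _ (by positivity) (fun x y => by
      refine (Finset.sum_le_sum fun k _ => ?_).trans
        (sum_norm_finProj_mul_norm_finProj_le hV hW hp hq hpq hc0 hc hd hC hD n x y)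
      rw [ContinuousLinearMap.comp_apply, map_tmul, hV.finProjL_apply, hW.finProjL_apply]
      exact ((φ k).le_of_opNorm_le (hφ k) _).trans ((one_mul _).trans_le (norm_tmul_le _ _))) z) hε
  have hk' : ‖R k (ζ (a (s k)))‖ ≤ ε := by
    simpa [hφR k] using hk
  have := hεζ (a (s k))
  rw [← ha] at this
  exact absurd hk' (not_le.2 this)

end Corner

theorem theorem3p12 {𝕜 : Type*} [RCLike 𝕜]
    {X : Type*} [NormedAddCommGroup X] [NormedSpace 𝕜 X] [CompleteSpace X]
    {Y : Type*} [NormedAddCommGroup Y] [NormedSpace 𝕜 Y] [CompleteSpace Y]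
    {I : Type*} [Countable I] {J : Type*} [Countable J]
    (V : I → Submodule 𝕜 X) (hV : IsUnconditionalSchauderDecomposition V)
    (hVfin : ∀ i, FiniteDimensional 𝕜 (V i))
    (W : J → Submodule 𝕜 Y) (hW : IsUnconditionalSchauderDecomposition W)
    (hWfin : ∀ j, FiniteDimensional 𝕜 (W j))
    (p q : ℝ) (hp : 1 < p) (hq : 1 < q) (hpq : 1 ≤ 1 / p + 1 / q)
    (hVp : hV.HasDisjointLowerEstimate p) (hWq : hW.HasDisjointLowerEstimate q)
    (hX : IsSCWCG 𝕜 X) (hY : IsSCWCG 𝕜 Y) :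
    IsSCWCG 𝕜 (ProjectiveTensorProduct 𝕜 X Y) := by
  obtain ⟨c, hc0, hc⟩ := hVp
  obtain ⟨d, hd0, hd⟩ := hWq
  have hc' := hV.norm_finProj_le (zero_lt_one.trans hp) hc
  have hd' := hW.norm_finProj_le (zero_lt_one.trans hq) hd
  -- The identity minus this approximant is exactly the corner `(1 - P_A) ⊗ (1 - Q_B)`.
  refine IsSCWCG.of_approx (ι := Finset I × Finset J)
    (T := fun a => ProjectiveTensorProduct.map (hV.finProjL hc' a.1) (.id 𝕜 Y) +
      ProjectiveTensorProduct.map (.id 𝕜 X - hV.finProjL hc' a.1) (hW.finProjL hd' a.2)) ?_ ?_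
  · rintro ⟨A, B⟩
    refine .add ?_ ?_
    · rw [IsUnconditionalSchauderDecomposition.finProjL, ProjectiveTensorProduct.map_sum_left]
      refine .sum _ fun i _ => ?_
      obtain ⟨n, φ, e, he⟩ := hV.exists_projL_eq_sum_smulRight hc' i
      rw [he, ProjectiveTensorProduct.map_sum_left]
      exact .sum _ fun k _ =>
        ProjectiveTensorProduct.hasCountablyGeneratedImages_map_smulRight_left hY _ _ _
    · dsimp only
      rw [IsUnconditionalSchauderDecomposition.finProjL.eq_1 hW, ProjectiveTensorProduct.map_sum_right]
      refine .sum _ fun j _ => ?_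
      obtain ⟨n, φ, e, he⟩ := hW.exists_projL_eq_sum_smulRight hd' j
      rw [he, ProjectiveTensorProduct.map_sum_right]
      exact .sum _ fun k _ =>
        ProjectiveTensorProduct.hasCountablyGeneratedImages_map_smulRight_right hX _ _ _
  · intro K hK ε hε
    obtain ⟨A, B, hAB⟩ := exists_corner_norm_le hV hW hp (zero_lt_one.trans hq) hpq hc0.le hd0.le
      hc hd hc' hd' hK hε
    refine ⟨(A, B), fun z hz => ?_⟩
    refine (congrArg norm ?_).trans_le (hAB z hz)
    rw [ProjectiveTensorProduct.map_sub_right, ProjectiveTensorProduct.map_sub_left _ _ (.id 𝕜 Y),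
      ProjectiveTensorProduct.map_id]
    simp only [add_apply, sub_apply, ContinuousLinearMap.id_apply]
    abel
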